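/- **Model.** A server serves $N$ users in slots $t=0,1,2,\dots$. In every slot each user $n$ has $a_{\max}$ potential packets. Prediction patterns (which of the $a_{\max}$ potential packets are predicted to arrive) are i.i.d. over slots and independent over users, with an arbitrary law. Given the prediction pattern of a slot, each predicted packet really arrives with probability $p_n$ and each packet that was not predicted arrives with probability $q_n$ (whatever the pattern), where $0\le q_n<p_n\le 1$; patterns of different slots and users are independent. Let $a_n$ be the mean number of arrivals of user $n$ per slot, and put $\tilde a_n=\frac{a_n-a_{\max}q_n}{p_n-q_n}$. The prediction pattern of slot $t$ is revealed in slot $t-D_n$, and the actual arrivals of slot $t$ are revealed in slot $t$. A packet of user $n$ arriving in slot $t$ may be transmitted in the $\tau_n$ slots $t,\dots,t+\tau_n-1$ and is then discarded; a predicted packet may also be transmitted in the $D_n$ slots before $t$ ($\tau_n,D_n\ge 0$ integers). In each slot, each undelivered packet that is present or predicted is either transmitted, at the cost of one resource unit, or not; a transmission to user $n$ succeeds independently with probability $\zeta_n\in(0,1]$. Resources spent on a false alarm are lost. The system state consists of the user, the time to deadline and the reception status of all these packets. A policy $\pi$ assigns to every system state a probability distribution on the possible sets of transmissions. For a fixed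 initial state, let $X_n(t)$ be the number of actual packets of user $n$ delivered in time (a packet delivered in advance is counted when its arrival is realized), and let $E_n(t)$ be the number of transmissions to user $n$ in slot $t$. With weights $\beta_n\ge0$ and budget $B\ge 0$, put $$x_n(\pi)=\lim_{T\to\infty}\tfrac1T\,\mathbb E\sum_{t<T}X_n(t),\qquad E_{av}(\pi)=\lim_{T\to\infty}\tfrac1T\,\mathbb E\sum_{t<T}\sum_{n}E_n(t),$$ $$L(\pi,\lambda)=\lim_{T\to\infty}\tfrac1T\,\mathbb E\sum_{t<T}\sum_{n}\big(\beta_nX_n(t)-\lambda E_n(t)\big)+\lambda B,$$ $$g_I(\lambda)=\max_\pi L(\pi,\lambda),\qquad \phi_I^*=\max\Big\{\sum_n\beta_nx_n(\pi)\;:\;E_{av}(\pi)\le B\Big\},$$ where the maxima are over the policies for which the limits concerned exist. **Statement.** For every initial state the following holds. For every $\lambda\ge 0$ the maximum defining $g_I(\lambda)$ is attained and $$g_I(\lambda)=\lambda B+\sum_{n:\,\zeta_n\beta_n>\lambda}\Big[\tilde a_n v_n(\lambda)+(a_{\max}-\tilde a_n)\,q_n\,\frac{1-(1-\zeta_n)^{\tau_n}}{\zeta_n}\,(\zeta_n\beta_n-\lambda)\Big],$$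 where, with $c_n=\dfrac{\lambda}{(\zeta_n\beta_n-\lambda)(1-\zeta_n)^{\tau_n}+\lambda}$ (and $c_n=0$ if the denominator is $0$), $$v_n(\lambda)=\begin{cases}p_n\dfrac{1-(1-\zeta_n)^{\tau_n}}{\zeta_n}(\zeta_n\beta_n-\lambda), & p_n\le c_n,\\[2mm] -(1-p_n)\dfrac{1-(1-\zeta_n)^{D_n}}{\zeta_n}\lambda+p_n\dfrac{1-(1-\zeta_n)^{\tau_n+D_n}}{\zeta_n}(\zeta_n\beta_n-\lambda), & p_n>c_n.\end{cases}$$ Moreover the maximum defining $\phi_I^*$ is attained, the function $g_I$ attains its minimum on $[0,\infty)$, and $$\phi_I^*=\min_{\lambda\ge0}g_I(\lambda).$$ -/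

import Mathlib

open Filter Topology

noncomputable section

namespace TimelyThroughput

/-- A static timely-throughput system with `N` users and imperfect prediction.  In every slot each
user has `aMax` potential packets; a prediction pattern marks some of them as predicted, and an
arrival pattern marks those that really arrive.  `predLaw n` is the law of the prediction pattern of
one slot and `arrLaw n w` is the law of the arrival pattern of that slot given its prediction
pattern `w`.  Different slots and different users are independent. -/
structure System (N : ℕ) where
  /-- number of potential arrivals per user and slot -/
  aMax : ℕ
  /-- deadlines -/
  τ : Fin N → ℕ
  /-- lengths of the prediction windows -/
  D : Fin N → ℕ
  /-- weights of the users -/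
  β : Fin N → ℝ
  /-- success probability of one transmission (resource level `1`) -/
  ζ : Fin N → ℝ
  /-- true-positive rates -/
  p : Fin N → ℝ
  /-- false-negative rates -/
  q : Fin N → ℝ
  /-- budget for the average resource expenditure -/
  B : ℝ
  predLaw : Fin N → (Fin aMax → Bool) → ℝ
  arrLaw : Fin N → (Fin aMax → Bool) → (Fin aMax → Bool) → ℝ
  β_nonneg : ∀ n, 0 ≤ β n
  ζ_pos : ∀ n, 0 < ζ n
  ζ_le_one : ∀ n, ζ n ≤ 1
  q_nonneg : ∀ n, 0 ≤ q n
  q_lt_p : ∀ n, q n < p n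
  p_le_one : ∀ n, p n ≤ 1
  B_nonneg : 0 ≤ B
  predLaw_prob : ∀ n, predLaw n ∈ stdSimplex ℝ (Fin aMax → Bool)
  arrLaw_prob : ∀ n w, arrLaw n w ∈ stdSimplex ℝ (Fin aMax → Bool)
  /-- Whatever the prediction pattern, a predicted packet arrives with probability `p n` and a
  packet that was not predicted arrives with probability `q n`. -/
  arrLaw_marginal : ∀ n w k,
    (∑ x : Fin aMax → Bool, if x k = true then arrLaw n w x else 0)
      = if w k = true then p n else q n

namespace System

variable {N : ℕ} (S : System N)

/-- The mean number `a n` of arrivals of user `n` per slot. -/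
def a (n : Fin N) : ℝ :=
  ∑ w : Fin S.aMax → Bool, ∑ x : Fin S.aMax → Bool,
    S.predLaw n w * S.arrLaw n w x * ((Finset.univ.filter fun k => x k = true).card : ℝ)

/-- The rate of predicted arrivals, as determined by `a n`, `p n`, `q n` and `aMax`. -/
def aTilde (n : Fin N) : ℝ := (S.a n - S.aMax * S.q n) / (S.p n - S.q n)

/-! ### The controlled Markov chain -/

/-- The state of the system.  Position `j` of user `n` holds the `aMax` potential packets whose time
to deadline is `j + 1`.  Positions `j < τ n` hold packets that have entered the system, positions
`τ n ≤ j` belong to the prediction window and hold predicted packets.  `none`: no packet;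
`some r`: a packet with reception status `r` (`true` if it has reached the destination). -/
abbrev State : Type := (n : Fin N) → Fin (S.τ n + S.D n) → Fin S.aMax → Option Bool

/-- A resource level in `{0, 1}` for every packet position. -/
abbrev Action : Type := (n : Fin N) → Fin (S.τ n + S.D n) → Fin S.aMax → Bool

/-- The randomness of one slot: transmission outcomes, the prediction patterns that are revealed at
the end of the slot, and the arrival patterns that are realized at the end of the slot. -/
abbrev Noise : Type :=
  ((n : Fin N) → Fin (S.τ n + S.D n) → Fin S.aMax → Bool) ×
    (Fin N → Fin S.aMax → Bool) × (Fin N → Fin S.aMax → Bool)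

variable {S}

/-- Only packets that are present and not yet delivered are transmitted. -/
def transmits (s : S.State) (u : S.Action) (n : Fin N) (j : Fin (S.τ n + S.D n))
    (k : Fin S.aMax) : Bool :=
  decide (s n j k = some false) && u n j k

/-- Packets of user `n` after the transmissions of the slot; position `i` holds the packets whose
time to deadline was `i + 1` and will be `i` in the next slot.  The last position holds the packets
of the newly revealed prediction pattern. -/
def window (s : S.State) (u : S.Action) (ω : S.Noise) (n : Fin N) :
    Fin (S.τ n + S.D n + 1) → Fin S.aMax → Option Bool :=
  Fin.snoc (α := fun _ => Fin S.aMax → Option Bool)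
    (fun j k => (s n j k).map fun r => r || (transmits s u n j k && ω.1 n j k))
    (fun k => if ω.2.1 n k = true then some false else none)

/-- The packets of user `n` whose predictions are verified at the end of the slot. -/
def due (s : S.State) (u : S.Action) (ω : S.Noise) (n : Fin N) : Fin S.aMax → Option Bool :=
  window s u ω n ⟨S.τ n, by omega⟩

/-- Verification: false alarms disappear, true positives keep their reception status, and arrivals
that were not predicted enter as undelivered packets. -/
def verify (x : Fin S.aMax → Bool) (c : Fin S.aMax → Option Bool) : Fin S.aMax → Option Bool :=
  fun k => if x k = true then some ((c k).getD false) else none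

/-- The state in the next slot. -/
def next (s : S.State) (u : S.Action) (ω : S.Noise) : S.State := fun n j =>
  if (j : ℕ) + 1 = S.τ n then verify (ω.2.2 n) (window s u ω n j.succ)
  else window s u ω n j.succ

/-- The probability of `ω` in a slot with state `s` and action `u`: transmissions to user `n` succeed
independently with probability `ζ n`, prediction patterns follow `predLaw`, arrival patterns follow
`arrLaw` given the prediction pattern of the same arrival slot. -/
def noiseProb (s : S.State) (u : S.Action) (ω : S.Noise) : ℝ :=
  (∏ n, ∏ j, ∏ k, if ω.1 n j k = true then S.ζ n else 1 - S.ζ n) *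
    (∏ n, S.predLaw n (ω.2.1 n)) *
    ∏ n, S.arrLaw n (fun k => (due s u ω n k).isSome) (ω.2.2 n)

/-- Timely deliveries of user `n` in one slot: successful transmissions of packets that have
arrived, and packets delivered in advance whose arrival is realized. -/
def deliveries (s : S.State) (u : S.Action) (ω : S.Noise) (n : Fin N) : ℕ :=
  (Finset.univ.filter fun jk : Fin (S.τ n + S.D n) × Fin S.aMax =>
      (jk.1 : ℕ) < S.τ n ∧ transmits s u n jk.1 jk.2 = true ∧ ω.1 n jk.1 jk.2 = true).card +
    (Finset.univ.filter fun k : Fin S.aMax =>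
      ω.2.2 n k = true ∧ due s u ω n k = some true).card

/-- Resource spent on user `n` in one slot: one unit per transmission. -/
def spending (s : S.State) (u : S.Action) (n : Fin N) : ℕ :=
  (Finset.univ.filter fun jk : Fin (S.τ n + S.D n) × Fin S.aMax =>
      transmits s u n jk.1 jk.2 = true).card

variable (S)

/-- A (randomized) scheduling policy: a probability distribution on actions for every state. -/
def Policy : Type := S.State → stdSimplex ℝ S.Action

variable {S}

/-- The law of the state in slot `t` when the policy `π` is started in the state `s₀`. -/
def stateProb (π : S.Policy) (s₀ : S.State) : ℕ → S.State → ℝ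
  | 0 => fun s => if s = s₀ then 1 else 0
  | t + 1 => fun s' => ∑ s : S.State, ∑ u : S.Action, ∑ ω : S.Noise,
      if next s u ω = s' then stateProb π s₀ t s * (π s).1 u * noiseProb s u ω else 0

/-- Expected number of timely deliveries of user `n` in slot `t`. -/
def expDeliveries (π : S.Policy) (s₀ : S.State) (t : ℕ) (n : Fin N) : ℝ :=
  ∑ s : S.State, ∑ u : S.Action, ∑ ω : S.Noise,
    stateProb π s₀ t s * (π s).1 u * noiseProb s u ω * (deliveries s u ω n : ℝ)

/-- Expected resource spent on user `n` in slot `t`. -/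
def expSpending (π : S.Policy) (s₀ : S.State) (t : ℕ) (n : Fin N) : ℝ :=
  ∑ s : S.State, ∑ u : S.Action, stateProb π s₀ t s * (π s).1 u * (spending s u n : ℝ)

/-- `x` is the timely-throughput of user `n` under `π`. -/
def HasThroughput (π : S.Policy) (s₀ : S.State) (n : Fin N) (x : ℝ) : Prop :=
  Tendsto (fun T : ℕ => (1 / (T : ℝ)) * ∑ t ∈ Finset.range T, expDeliveries π s₀ t n) atTop (𝓝 x)

/-- `E` is the average resource expenditure under `π`. -/
def HasSpending (π : S.Policy) (s₀ : S.State) (E : ℝ) : Prop :=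
  Tendsto (fun T : ℕ => (1 / (T : ℝ)) * ∑ t ∈ Finset.range T, ∑ n, expSpending π s₀ t n)
    atTop (𝓝 E)

/-- `ℓ` is the value `L(π, lam)` of the Lagrangian. -/
def HasLagrangian (π : S.Policy) (s₀ : S.State) (lam ℓ : ℝ) : Prop :=
  Tendsto (fun T : ℕ => (1 / (T : ℝ)) *
      ((∑ n, ∑ t ∈ Finset.range T, S.β n * expDeliveries π s₀ t n) -
        lam * ∑ t ∈ Finset.range T, ∑ n, expSpending π s₀ t n) + lam * S.B)
    atTop (𝓝 ℓ)

variable (S)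

/-- The values of the Lagrangian over all policies. -/
def lagrangianValues (s₀ : S.State) (lam : ℝ) : Set ℝ :=
  {ℓ | ∃ π : S.Policy, HasLagrangian π s₀ lam ℓ}

/-- The dual function `g_I`. -/
def dualFunction (s₀ : S.State) (lam : ℝ) : ℝ := sSup (S.lagrangianValues s₀ lam)

/-- The weighted timely-throughputs of the policies whose average expenditure is at most `B`. -/
def feasibleValues (s₀ : S.State) : Set ℝ :=
  {φ | ∃ (π : S.Policy) (x : Fin N → ℝ) (E : ℝ), (∀ n, HasThroughput π s₀ n (x n)) ∧
    HasSpending π s₀ E ∧ E ≤ S.B ∧ φ = ∑ n, S.β n * x n}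

/-- The optimal weighted timely-throughput `φ_I^*`. -/
def optimalThroughput (s₀ : S.State) : ℝ := sSup (S.feasibleValues s₀)

/-! ### The explicit formula -/

/-- The threshold `c_n`. -/
def c (lam : ℝ) (n : Fin N) : ℝ :=
  lam / ((-lam + S.ζ n * S.β n) * (1 - S.ζ n) ^ S.τ n + lam)

open Classical in
/-- The function `v_n`. -/
def v (lam : ℝ) (n : Fin N) : ℝ :=
  if S.p n ≤ S.c lam n then
    S.p n * ((1 - (1 - S.ζ n) ^ S.τ n) / S.ζ n) * (-lam + S.ζ n * S.β n)
  else
    -(1 - S.p n) * ((1 - (1 - S.ζ n) ^ S.D n) / S.ζ n) * lam +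
      S.p n * ((1 - (1 - S.ζ n) ^ (S.τ n + S.D n)) / S.ζ n) * (-lam + S.ζ n * S.β n)

open Classical in
/-- The explicit expression for the dual function. -/
def dualFormula (lam : ℝ) : ℝ :=
  lam * S.B + ∑ n ∈ Finset.univ.filter (fun n => lam < S.ζ n * S.β n),
    (S.aTilde n * S.v lam n +
      (S.aMax - S.aTilde n) * S.q n * ((1 - (1 - S.ζ n) ^ S.τ n) / S.ζ n) *
        (-lam + S.ζ n * S.β n))

end System

end TimelyThroughput

end

noncomputable section

namespace TimelyThroughput

/-! ### Expectations under product laws -/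

/-! With a price `lam` per transmission, the Lagrangian decouples into single packets. The optimal
value of an undelivered packet grows by `max 0 gain` with each further slot in which it may be sent.
For an arrived packet this recursion starts from 0, for a predicted one from `p n` times the value
of a fresh arrival. In the prediction window a position without a prediction is worth `q n` times a
fresh arrival, and a packet delivered in advance is worth `p n * β n`. Summing these values over the
state gives a potential. In every slot the expected reward plus the expected change of potential is
a constant rate plus a sum of `gap` terms (`expected_balance`); these are nonpositive, and zero on
average under optimal decisions (`gap_best`). Only sums over packets occur, so correlations within a
pattern are irrelevant and only marginals enter.

The potential is bounded, so telescoping bounds the Lagrangian of every policy by the rate, from any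
initial state. Policies that transmit each position independently, with optimal probabilities,
attain the bound. The gain keeps its sign along each recursion, so the value has a closed form, with
one threshold case for predicted packets.

For strong duality, take the least multiplier at which some optimal independent policy respects the
budget. If it is positive, optimal policies for smaller multipliers overspend, and by compactness
some optimal policy at the least multiplier spends at least `B`. Optimal transmission probabilities
form a convex set on which spending is continuous, so some optimal policy spends exactly `B`. This
complementary slackness (`exists_complementary_slackness`), combined with weak duality, closes the
gap. -/

theorem sum_prod_eq_one {ι : Type*} [Fintype ι] [DecidableEq ι] {κ : ι → Type*}
    [∀ i, Fintype (κ i)] (w : ∀ i, κ i → ℝ) (hw : ∀ i, ∑ b, w i b = 1) :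
    ∑ x : (∀ i, κ i), ∏ i, w i (x i) = 1 := by
  rw [← Fintype.prod_sum]
  simp [hw]

/-- The function is absorbed into the factor at `i₀`; the sum of products then factorizes and the
other factors are 1. -/
theorem sum_prod_mul_apply {ι : Type*} [Fintype ι] [DecidableEq ι] {κ : ι → Type*}
    [∀ i, Fintype (κ i)] (w : ∀ i, κ i → ℝ) (hw : ∀ i, ∑ b, w i b = 1) (i₀ : ι)
    (f : κ i₀ → ℝ) :
    ∑ x : (∀ i, κ i), (∏ i, w i (x i)) * f (x i₀) = ∑ b, w i₀ b * f b := by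
  have key : ∀ x : (∀ i, κ i), (∏ i, w i (x i)) * f (x i₀) =
      ∏ i, Function.update w i₀ (fun b => w i₀ b * f b) i (x i) := by
    intro x
    have herase : ∏ i ∈ Finset.univ.erase i₀,
        Function.update w i₀ (fun b => w i₀ b * f b) i (x i) =
          ∏ i ∈ Finset.univ.erase i₀, w i (x i) :=
      Finset.prod_congr rfl fun i hi => by
        rw [Function.update_of_ne (Finset.ne_of_mem_erase hi)]
    rw [← Finset.mul_prod_erase _ _ (Finset.mem_univ i₀),
      ← Finset.mul_prod_erase _ (fun i => Function.update w i₀ _ i (x i)) (Finset.mem_univ i₀),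
      herase, Function.update_self]
    ring
  simp_rw [key]
  rw [← Fintype.prod_sum, ← Finset.mul_prod_erase _ _ (Finset.mem_univ i₀), Function.update_self,
    Finset.prod_eq_one, mul_one]
  intro i hi
  rw [Function.update_of_ne (Finset.ne_of_mem_erase hi), hw]

section Triple

variable {N K : ℕ} {m : Fin N → ℕ} (w : (n : Fin N) → Fin (m n) → Bool → ℝ)

theorem sum_triple_prod (hw : ∀ n j, ∑ b, w n j b = 1) :
    ∑ x : (n : Fin N) → Fin (m n) → Fin K → Bool, ∏ n, ∏ j, ∏ k, w n j (x n j k) = 1 :=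
  sum_prod_eq_one (fun n (y : Fin (m n) → Fin K → Bool) => ∏ j, ∏ k, w n j (y j k)) fun n =>
    sum_prod_eq_one (fun j (y : Fin K → Bool) => ∏ k, w n j (y k)) fun j =>
      sum_prod_eq_one (fun _ => w n j) fun _ => hw n j

theorem sum_triple_prod_mul_apply (hw : ∀ n j, ∑ b, w n j b = 1) (n : Fin N) (j : Fin (m n))
    (k : Fin K) (f : Bool → ℝ) :
    ∑ x : (n : Fin N) → Fin (m n) → Fin K → Bool,
      (∏ n, ∏ j, ∏ k, w n j (x n j k)) * f (x n j k) = ∑ b, w n j b * f b := by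
  have h3 : ∀ n j, ∑ y : Fin K → Bool, ∏ k, w n j (y k) = 1 := fun n j =>
    sum_prod_eq_one (fun _ => w n j) fun _ => hw n j
  have h2 : ∀ n, ∑ y : Fin (m n) → Fin K → Bool, ∏ j, ∏ k, w n j (y j k) = 1 := fun n =>
    sum_prod_eq_one (fun j (y : Fin K → Bool) => ∏ k, w n j (y k)) (h3 n)
  rw [sum_prod_mul_apply (fun n (y : Fin (m n) → Fin K → Bool) => ∏ j, ∏ k, w n j (y j k)) h2 n
      (fun y => f (y j k)),
    sum_prod_mul_apply (fun j (y : Fin K → Bool) => ∏ k, w n j (y k)) (h3 n) j (fun y => f (y k)),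
    sum_prod_mul_apply (fun _ => w n j) (fun _ => hw n j) k f]

theorem sum_triple_prod_mul_sum (hw : ∀ n j, ∑ b, w n j b = 1) (n : Fin N)
    (f : Fin (m n) → Fin K → Bool → ℝ) :
    ∑ x : (n : Fin N) → Fin (m n) → Fin K → Bool,
      (∏ n, ∏ j, ∏ k, w n j (x n j k)) * ∑ j, ∑ k, f j k (x n j k) =
        ∑ j, ∑ k, ∑ b, w n j b * f j k b := by
  simp_rw [Finset.mul_sum]
  rw [Finset.sum_comm]
  refine Finset.sum_congr rfl fun j _ => ?_
  rw [Finset.sum_comm]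
  refine Finset.sum_congr rfl fun k _ => ?_
  exact sum_triple_prod_mul_apply w hw n j k (f j k)

end Triple

/-! ### Averages of a sequence with a bounded potential -/

theorem tendsto_potential_average {H : ℕ → ℝ} {C : ℝ} (hH : ∀ t, |H t| ≤ C) :
    Tendsto (fun T : ℕ => (1 / (T : ℝ)) * (H 0 - H T)) atTop (𝓝 0) := by
  have h1 : Tendsto (fun T : ℕ => (1 / (T : ℝ)) * (C + C)) atTop (𝓝 0) := by
    simpa using (tendsto_one_div_atTop_nhds_zero_nat (𝕜 := ℝ)).mul_const (C + C)
  refine squeeze_zero_norm (fun T => ?_) h1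
  rw [norm_mul, Real.norm_of_nonneg (by positivity : (0 : ℝ) ≤ 1 / (T : ℝ)), Real.norm_eq_abs]
  gcongr
  calc |H 0 - H T| ≤ |H 0| + |H T| := abs_sub _ _
    _ ≤ C + C := add_le_add (hH 0) (hH T)

/-- The Poisson equation telescopes: the sum differs from `T * ρ` by `H 0 - H T`, which is bounded.
-/
theorem tendsto_average_of_poisson {f H : ℕ → ℝ} {ρ C : ℝ} (hH : ∀ t, |H t| ≤ C)
    (hf : ∀ t, f t + H (t + 1) - H t = ρ) :
    Tendsto (fun T : ℕ => (1 / (T : ℝ)) * ∑ t ∈ Finset.range T, f t) atTop (𝓝 ρ) := by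
  have hsum : ∀ T : ℕ, ∑ t ∈ Finset.range T, f t = T * ρ + (H 0 - H T) := by
    intro T
    induction T with
    | zero => simp
    | succ T ih => rw [Finset.sum_range_succ, ih]; push_cast; linarith [hf T]
  have h := (tendsto_potential_average hH).const_add ρ
  rw [add_zero] at h
  refine h.congr' ?_
  filter_upwards [eventually_gt_atTop 0] with T hT
  rw [hsum]
  have : (T : ℝ) ≠ 0 := by positivity
  field_simp

theorem average_le_of_poisson {f H : ℕ → ℝ} {ρ C ℓ : ℝ} (hH : ∀ t, |H t| ≤ C)
    (hf : ∀ t, f t + H (t + 1) - H t ≤ ρ)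
    (hℓ : Tendsto (fun T : ℕ => (1 / (T : ℝ)) * ∑ t ∈ Finset.range T, f t) atTop (𝓝 ℓ)) :
    ℓ ≤ ρ := by
  have hsum : ∀ T : ℕ, ∑ t ∈ Finset.range T, f t ≤ T * ρ + (H 0 - H T) := by
    intro T
    induction T with
    | zero => simp
    | succ T ih => rw [Finset.sum_range_succ]; push_cast; linarith [hf T]
  have h := (tendsto_potential_average hH).const_add ρ
  rw [add_zero] at h
  refine le_of_tendsto_of_tendsto hℓ h ?_
  filter_upwards [eventually_gt_atTop 0] with T hT
  have hT' : (0 : ℝ) < T := by positivity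
  calc (1 / (T : ℝ)) * ∑ t ∈ Finset.range T, f t
      ≤ (1 / (T : ℝ)) * (T * ρ + (H 0 - H T)) := by gcongr; exact hsum T
    _ = _ := by field_simp

end TimelyThroughput

end

noncomputable section

namespace TimelyThroughput
namespace System

variable {N : ℕ} {S : System N}

/-! ### The noise of one slot -/

theorem sum_success_weight (n : Fin N) :
    ∑ b : Bool, (if b = true then S.ζ n else 1 - S.ζ n) = 1 := by simp

theorem noiseProb_nonneg (s : S.State) (u : S.Action) (ω : S.Noise) : 0 ≤ noiseProb s u ω := by
  refine mul_nonneg (mul_nonneg ?_ ?_) ?_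
  · refine Finset.prod_nonneg fun n _ => Finset.prod_nonneg fun j _ => Finset.prod_nonneg fun k _ => ?_
    split_ifs
    · exact (S.ζ_pos n).le
    · linarith [S.ζ_le_one n]
  · exact Finset.prod_nonneg fun n _ => (S.predLaw_prob n).1 _
  · exact Finset.prod_nonneg fun n _ => (S.arrLaw_prob n _).1 _

/-- The law of the transmission outcomes. -/
def successProb (y : (n : Fin N) → Fin (S.τ n + S.D n) → Fin S.aMax → Bool) : ℝ :=
  ∏ n, ∏ j, ∏ k, if y n j k = true then S.ζ n else 1 - S.ζ n

/-- The law of the prediction patterns revealed in one slot. -/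
def revealProb (z : Fin N → Fin S.aMax → Bool) : ℝ := ∏ n, S.predLaw n (z n)

/-- The window after the transmissions of the slot, as a function of the transmission outcomes and
the newly revealed prediction patterns. -/
def windowOf (s : S.State) (u : S.Action)
    (y : (n : Fin N) → Fin (S.τ n + S.D n) → Fin S.aMax → Bool)
    (z : Fin N → Fin S.aMax → Bool) (n : Fin N) :
    Fin (S.τ n + S.D n + 1) → Fin S.aMax → Option Bool :=
  window s u (y, z, fun _ _ => false) n

/-- The index of the position whose packets are verified. -/
def dueIndex (S : System N) (n : Fin N) : Fin (S.τ n + S.D n + 1) := ⟨S.τ n, by omega⟩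

/-- The arrival law depends on the pattern that is due, which for `D n = 0` is the one just
revealed. Arrivals are therefore averaged first, conditionally on the rest. The window does not read
the arrival component, so the dummy pattern in `windowOf` is harmless. -/
theorem sum_noiseProb_mul (s : S.State) (u : S.Action) (F : S.Noise → ℝ) :
    ∑ ω, noiseProb s u ω * F ω =
      ∑ y, successProb (S := S) y * ∑ z, revealProb (S := S) z *
        ∑ x : Fin N → Fin S.aMax → Bool,
          (∏ n, S.arrLaw n (fun k => (windowOf s u y z n (S.dueIndex n) k).isSome) (x n)) *
            F (y, z, x) := by
  rw [Fintype.sum_prod_type]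
  refine Finset.sum_congr rfl fun y _ => ?_
  rw [Fintype.sum_prod_type, Finset.mul_sum]
  refine Finset.sum_congr rfl fun z _ => ?_
  rw [Finset.mul_sum, Finset.mul_sum]
  refine Finset.sum_congr rfl fun x _ => ?_
  simp only [noiseProb, successProb, revealProb]
  rw [mul_assoc, mul_assoc]
  rfl

theorem sum_successProb : ∑ y, successProb (S := S) y = 1 :=
  sum_triple_prod (fun n _ b => if b = true then S.ζ n else 1 - S.ζ n)
    fun n _ => sum_success_weight n

theorem sum_revealProb : ∑ z, revealProb (S := S) z = 1 :=
  sum_prod_eq_one S.predLaw fun n => (S.predLaw_prob n).2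

theorem sum_noiseProb (s : S.State) (u : S.Action) : ∑ ω, noiseProb s u ω = 1 := by
  have h := sum_noiseProb_mul s u fun _ => 1
  simp only [mul_one] at h
  rw [h]
  simp_rw [sum_prod_eq_one (fun n => S.arrLaw n _) fun n => (S.arrLaw_prob n _).2, mul_one,
    sum_revealProb, mul_one, sum_successProb]

/-- The mean number of predicted packets per slot is `aTilde`. -/
theorem aTilde_eq (n : Fin N) :
    S.aTilde n = ∑ w, S.predLaw n w * ∑ k, if w k = true then 1 else 0 := by
  have hpq : S.p n - S.q n ≠ 0 := (sub_pos.2 (S.q_lt_p n)).ne'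
  have ha : S.a n = ∑ w, S.predLaw n w * ∑ k, if w k = true then S.p n else S.q n := by
    unfold a
    refine Finset.sum_congr rfl fun w _ => ?_
    simp_rw [mul_assoc]
    rw [← Finset.mul_sum]
    congr 1
    simp_rw [← S.arrLaw_marginal n w]
    rw [Finset.sum_comm]
    refine Finset.sum_congr rfl fun x _ => ?_
    rw [Finset.natCast_card_filter, Finset.mul_sum]
    refine Finset.sum_congr rfl fun k _ => ?_
    split_ifs <;> simp
  -- An unpredicted packet contributes `q n`, and each prediction adds `p n - q n`; this is solved
  -- for the mean number of predictions.
  have hk : ∀ w : Fin S.aMax → Bool, (∑ k, if w k = true then S.p n else S.q n) =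
      S.aMax * S.q n + (S.p n - S.q n) * ∑ k, if w k = true then 1 else 0 := by
    intro w
    have : ∀ k, (if w k = true then S.p n else S.q n) =
        S.q n + (S.p n - S.q n) * if w k = true then 1 else 0 := by
      intro k; split_ifs <;> ring
    simp_rw [this, Finset.sum_add_distrib, ← Finset.mul_sum]
    simp
  rw [aTilde, ha, div_eq_iff hpq]
  simp_rw [hk, mul_add, Finset.sum_add_distrib, ← Finset.sum_mul, (S.predLaw_prob n).2]
  rw [one_mul, add_sub_cancel_left, Finset.sum_mul]
  refine Finset.sum_congr rfl fun w _ => by ring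

/-! ### Packet values -/

/-- The value of a potential packet that has entered the system, if an undelivered one is worth
`g`. -/
def presentValue (g : ℝ) : Option Bool → ℝ
  | some false => g
  | _ => 0

/-- The value of a potential packet of the prediction window, if an undelivered predicted one is
worth `g'`, an undelivered packet that has just arrived is worth `g`, and a delivery is worth
`b`. -/
def windowValue (S : System N) (n : Fin N) (b g g' : ℝ) : Option Bool → ℝ
  | none => S.q n * g
  | some false => g'
  | some true => S.p n * b

/-- The value of a packet before the slot; `G m` and `U m` are the values of undelivered packets
that have arrived, with `m` slots left, and of predicted ones, with `m` slots until verification. -/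
def stateValue (S : System N) (n : Fin N) (b : ℝ) (G U : ℕ → ℝ) (j : ℕ) : Option Bool → ℝ :=
  if j < S.τ n then presentValue (G (j + 1)) else S.windowValue n b (G (S.τ n)) (U (j + 1 - S.τ n))

/-- The value of a packet after the transmissions of the slot. -/
def postValue (S : System N) (n : Fin N) (b : ℝ) (G U : ℕ → ℝ) (i : ℕ) : Option Bool → ℝ :=
  if i < S.τ n then presentValue (G i) else S.windowValue n b (G (S.τ n)) (U (i - S.τ n))

/-- Aging moves window position `j + 1` to state position `j` without changing values, except at
verification, where `j + 1 = τ n`. -/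
theorem stateValue_of_ne {n : Fin N} {b : ℝ} {G U : ℕ → ℝ} {j : ℕ} (h : j + 1 ≠ S.τ n) :
    S.stateValue n b G U j = S.postValue n b G U (j + 1) := by
  unfold stateValue postValue
  by_cases hj : j < S.τ n
  · rw [if_pos hj, if_pos (by omega)]
  · rw [if_neg hj, if_neg (by omega)]

theorem stateValue_of_eq {n : Fin N} {b : ℝ} {G U : ℕ → ℝ} {j : ℕ} (h : j + 1 = S.τ n) :
    S.stateValue n b G U j = presentValue (G (S.τ n)) := by
  rw [stateValue, if_pos (by omega), h]

/-- The total value of the packets of user `n`. -/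
def potential (n : Fin N) (b : ℝ) (G U : ℕ → ℝ) (s : S.State) : ℝ :=
  ∑ j : Fin (S.τ n + S.D n), ∑ k, S.stateValue n b G U j (s n j k)

/-- The rate at which value is created by user `n`. -/
def valueRate (S : System N) (n : Fin N) (G U : ℕ → ℝ) : ℝ :=
  S.aTilde n * U (S.D n) + (S.aMax - S.aTilde n) * S.q n * G (S.τ n)

/-- The integrand is a sum over packets, so the marginals of the arrival law suffice. The hypothesis
`hg` says that a predicted undelivered packet at verification is worth `p n` times a fresh arrival.
-/
theorem sum_arrLaw_mul_apply (n : Fin N) (c : Fin S.aMax → Option Bool) {b g g' : ℝ}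
    (hg : g' = S.p n * g) :
    ∑ x, S.arrLaw n (fun k => (c k).isSome) x *
        ∑ k, (if x k = true then (if c k = some true then b else g) else 0) =
      ∑ k, S.windowValue n b g g' (c k) := by
  simp_rw [Finset.mul_sum]
  rw [Finset.sum_comm]
  refine Finset.sum_congr rfl fun k _ => ?_
  have h := S.arrLaw_marginal n (fun k => (c k).isSome) k
  calc _ = (∑ x : Fin S.aMax → Bool, if x k = true then
            S.arrLaw n (fun k => (c k).isSome) x else 0) * (if c k = some true then b else g) := by
        rw [Finset.sum_mul]
        refine Finset.sum_congr rfl fun x _ => ?_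
        split_ifs <;> simp
    _ = _ := by
        rw [h]
        rcases hc : c k with _ | _ | _ <;> simp [windowValue, hg]

/-- Expectation over the arrivals. -/
theorem sum_arrLaw_mul_potential (s : S.State) (u : S.Action) (n : Fin N) {b : ℝ} {G U : ℕ → ℝ}
    (hG : G 0 = 0) (hU : U 0 = S.p n * G (S.τ n))
    (y : (n : Fin N) → Fin (S.τ n + S.D n) → Fin S.aMax → Bool) (z : Fin N → Fin S.aMax → Bool) :
    ∑ x : Fin N → Fin S.aMax → Bool,
      (∏ n, S.arrLaw n (fun k => (windowOf s u y z n (S.dueIndex n) k).isSome) (x n)) *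
        (b * ((Finset.univ.filter fun k : Fin S.aMax =>
            x n k = true ∧ windowOf s u y z n (S.dueIndex n) k = some true).card : ℝ) +
          potential n b G U (next s u (y, z, x))) =
      ∑ i : Fin (S.τ n + S.D n + 1), ∑ k, S.postValue n b G U i (windowOf s u y z n i k) := by
  set W := windowOf s u y z n
  -- the contribution of position `i` of the window
  let A : Fin (S.τ n + S.D n + 1) → (Fin S.aMax → Bool) → ℝ := fun i x =>
    if (i : ℕ) = S.τ n then
      ∑ k, (if x k = true then (if W i k = some true then b else G (S.τ n)) else 0)
    else ∑ k, S.postValue n b G U i (W i k)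
  have hsplit : ∀ x : Fin N → Fin S.aMax → Bool,
      b * ((Finset.univ.filter fun k : Fin S.aMax =>
            x n k = true ∧ W (S.dueIndex n) k = some true).card : ℝ) +
          potential n b G U (next s u (y, z, x)) = ∑ i, A i (x n) := by
    intro x
    have hcard : b * ((Finset.univ.filter fun k : Fin S.aMax =>
            x n k = true ∧ W (S.dueIndex n) k = some true).card : ℝ) =
        ∑ i : Fin (S.τ n + S.D n + 1), if i = S.dueIndex n then
          ∑ k, (if x n k = true ∧ W i k = some true then b else 0) else 0 := by
      rw [Finset.sum_ite_eq' , if_pos (Finset.mem_univ _), Finset.natCast_card_filter,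
        Finset.mul_sum]
      exact Finset.sum_congr rfl fun k _ => by split_ifs <;> simp
    rw [hcard, potential, Fin.sum_univ_succ, Fin.sum_univ_succ, add_assoc,
      ← Finset.sum_add_distrib]
    have hidx : ∀ i : Fin (S.τ n + S.D n + 1), i = S.dueIndex n ↔ (i : ℕ) = S.τ n := fun i => by
      rw [Fin.ext_iff]; rfl
    simp only [hidx]
    congr 1
    -- Position 0 leaves the system. If `τ n = 0` it is the position being verified, and arrivals
    -- there have no slot left, so `G (τ n) = 0`; otherwise its packets expire with value `G 0 = 0`.
    · by_cases h0 : 0 = S.τ n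
      · simp only [A, Fin.val_zero, eq_true h0, ↓reduceIte]
        refine Finset.sum_congr rfl fun k _ => ?_
        have hGτ : G (S.τ n) = 0 := h0 ▸ hG
        rw [hGτ]
        split_ifs <;> simp_all
      · simp only [A, Fin.val_zero, eq_false h0, postValue,
          eq_true (Nat.pos_of_ne_zero (Ne.symm h0)), hG, ↓reduceIte]
        symm
        refine Finset.sum_eq_zero fun k _ => ?_
        rcases W 0 k with _ | _ | _ <;> simp [presentValue]
    · refine Finset.sum_congr rfl fun j _ => ?_
      have hnext : next s u (y, z, x) n j =
          if (j : ℕ) + 1 = S.τ n then verify (x n) (W j.succ) else W j.succ := rfl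
      by_cases hj : (j : ℕ) + 1 = S.τ n
      · simp only [A, Fin.val_succ, eq_true hj, hnext, ↓reduceIte]
        rw [← Finset.sum_add_distrib]
        refine Finset.sum_congr rfl fun k _ => ?_
        rw [stateValue_of_eq hj]
        unfold verify
        by_cases hx : x n k = true
        · rcases hc : W j.succ k with _ | _ | _ <;> simp [hx, presentValue]
        · simp [hx, presentValue]
      · simp only [A, Fin.val_succ, eq_false hj, hnext, zero_add, ↓reduceIte]
        rw [stateValue_of_ne hj]
  simp_rw [hsplit]
  rw [sum_prod_mul_apply (fun n => S.arrLaw n _) (fun n => (S.arrLaw_prob n _).2) n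
    (fun x => ∑ i, A i x)]
  simp_rw [Finset.mul_sum]
  rw [Finset.sum_comm]
  refine Finset.sum_congr rfl fun i _ => ?_
  by_cases hi : (i : ℕ) = S.τ n
  · have hi' : i = S.dueIndex n := Fin.ext hi
    subst hi'
    simp only [A, if_pos hi]
    rw [sum_arrLaw_mul_apply n (W (S.dueIndex n)) hU]
    refine Finset.sum_congr rfl fun k _ => ?_
    rw [postValue, if_neg (by omega), hi, Nat.sub_self]
  · simp only [A, if_neg hi]
    rw [← Finset.sum_mul, (S.arrLaw_prob n _).2, one_mul]

/-- The change of the expected value of an undelivered packet in position `j`, if it is transmitted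
with probability `a` at cost `c`. -/
def gap (S : System N) (n : Fin N) (b c : ℝ) (G U : ℕ → ℝ) (j : ℕ) (a : ℝ) : ℝ :=
  if j < S.τ n then G j - G (j + 1) + a * (S.ζ n * (b - G j) - c)
  else U (j - S.τ n) - U (j + 1 - S.τ n) + a * (S.ζ n * (S.p n * b - U (j - S.τ n)) - c)

/-- One real number per Boolean. -/
def indicator (a : Bool) : ℝ := if a = true then 1 else 0

/-- Expectation over the outcome of the transmission of a packet. -/
theorem sum_success_packet (n : Fin N) (b c : ℝ) (G U : ℕ → ℝ) (j : ℕ) (r : Option Bool)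
    (a : Bool) :
    ∑ o : Bool, (if o = true then S.ζ n else 1 - S.ζ n) *
        ((if j < S.τ n ∧ (decide (r = some false) && a) = true ∧ o = true then b else 0) +
          S.postValue n b G U j (r.map fun d => d || ((decide (r = some false) && a) && o))) =
      S.stateValue n b G U j r +
        (c * indicator (decide (r = some false) && a) +
          if r = some false then S.gap n b c G U j (indicator a) else 0) := by
  unfold postValue stateValue gap indicator
  by_cases hj : j < S.τ n
  · rcases r with _ | _ | _ <;> rcases a with _ | _ <;>
      simp [hj, presentValue] <;> ring
  · rcases r with _ | _ | _ <;> rcases a with _ | _ <;>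
      simp [hj, windowValue] <;> ring

/-- The one-slot balance of the value of the packets of user `n`. -/
theorem sum_noiseProb_mul_potential (s : S.State) (u : S.Action) (n : Fin N) (b c : ℝ)
    {G U : ℕ → ℝ} (hG : G 0 = 0) (hU : U 0 = S.p n * G (S.τ n)) :
    ∑ ω, noiseProb s u ω * (b * (deliveries s u ω n : ℝ) + potential n b G U (next s u ω)) =
      S.valueRate n G U + potential n b G U s + c * (spending s u n : ℝ) +
        ∑ j, ∑ k, if s n j k = some false then S.gap n b c G U j (indicator (u n j k)) else 0 := by
  rw [sum_noiseProb_mul]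
  -- After averaging over arrivals, `φ` is the contribution of a packet already in the window and
  -- `ψ` that of the newly revealed pattern; each depends on few coordinates of the noise.
  let φ : Fin (S.τ n + S.D n) → Fin S.aMax → Bool → ℝ := fun j k o =>
    (if (j : ℕ) < S.τ n ∧ (decide (s n j k = some false) && u n j k) = true ∧ o = true
      then b else 0) +
      S.postValue n b G U j
        ((s n j k).map fun d => d || ((decide (s n j k = some false) && u n j k) && o))
  let ψ : (Fin S.aMax → Bool) → ℝ := fun w =>
    ∑ k, S.windowValue n b (G (S.τ n)) (U (S.D n)) (if w k = true then some false else none)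
  have harr : ∀ y z, ∑ x : Fin N → Fin S.aMax → Bool,
      (∏ n, S.arrLaw n (fun k => (windowOf s u y z n (S.dueIndex n) k).isSome) (x n)) *
        (b * (deliveries s u (y, z, x) n : ℝ) + potential n b G U (next s u (y, z, x))) =
      ∑ j, ∑ k, φ j k (y n j k) + ψ (z n) := by
    intro y z
    have hdel : ∀ x : Fin N → Fin S.aMax → Bool, (deliveries s u (y, z, x) n : ℝ) =
        ((Finset.univ.filter fun jk : Fin (S.τ n + S.D n) × Fin S.aMax =>
          (jk.1 : ℕ) < S.τ n ∧ transmits s u n jk.1 jk.2 = true ∧ y n jk.1 jk.2 = true).card : ℝ) +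
        ((Finset.univ.filter fun k : Fin S.aMax =>
          x n k = true ∧ windowOf s u y z n (S.dueIndex n) k = some true).card : ℝ) := fun x => by
      rw [← Nat.cast_add]; rfl
    simp_rw [hdel, mul_add b, add_assoc, mul_add (∏ n, _)]
    rw [Finset.sum_add_distrib, ← Finset.sum_mul,
      sum_prod_eq_one (fun n => S.arrLaw n _) fun n => (S.arrLaw_prob n _).2, one_mul]
    simp_rw [← mul_add (∏ n, _)]
    rw [sum_arrLaw_mul_potential s u n hG hU, Finset.natCast_card_filter, Fintype.sum_prod_type,
      Finset.mul_sum, Fin.sum_univ_castSucc, ← add_assoc, ← Finset.sum_add_distrib]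
    congr 1
    · refine Finset.sum_congr rfl fun j _ => ?_
      rw [Finset.mul_sum, ← Finset.sum_add_distrib]
      refine Finset.sum_congr rfl fun k _ => ?_
      have hw : windowOf s u y z n j.castSucc k = (s n j k).map fun d =>
          d || ((decide (s n j k = some false) && u n j k) && y n j k) := by
        simp only [windowOf, window, Fin.snoc_castSucc, transmits]
      rw [hw]
      -- The two sides carry different decidability instances.
      have hite : ∀ (P : Prop) (i₁ i₂ : Decidable P), b * @ite ℝ P i₁ 1 0 = @ite ℝ P i₂ b 0 := by
        intro P i₁ i₂
        by_cases hP : P <;> simp [hP]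
      exact congrArg₂ (· + ·) (hite _ _ _) rfl
    · refine Finset.sum_congr rfl fun k _ => ?_
      have hw : windowOf s u y z n (Fin.last _) k = if z n k = true then some false else none := by
        simp only [windowOf, window, Fin.snoc_last]
      rw [hw, postValue, if_neg (by simp)]
      simp
  simp_rw [harr, mul_add, Finset.sum_add_distrib, ← Finset.sum_mul, sum_revealProb, one_mul]
  simp_rw [mul_add, Finset.sum_add_distrib, ← Finset.sum_mul]
  rw [sum_successProb, one_mul]
  simp only [successProb, revealProb]
  rw [sum_triple_prod_mul_sum (m := fun n => S.τ n + S.D n) (K := S.aMax)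
      (fun n _ b => if b = true then S.ζ n else 1 - S.ζ n)
      (fun n _ => sum_success_weight n) n φ,
    sum_prod_mul_apply S.predLaw (fun n => (S.predLaw_prob n).2) n ψ]
  have hψ : ∑ w, S.predLaw n w * ψ w = S.valueRate n G U := by
    have hw : ∀ w, ψ w = S.aMax * (S.q n * G (S.τ n)) +
        (U (S.D n) - S.q n * G (S.τ n)) * ∑ k, if w k = true then 1 else 0 := by
      intro w
      have : ∀ k, S.windowValue n b (G (S.τ n)) (U (S.D n))
          (if w k = true then some false else none) = S.q n * G (S.τ n) +
            (U (S.D n) - S.q n * G (S.τ n)) * if w k = true then 1 else 0 := by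
        intro k; split_ifs <;> simp [windowValue]
      simp_rw [ψ, this, Finset.sum_add_distrib, ← Finset.mul_sum]
      simp [mul_left_comm]
    simp_rw [hw, mul_add, Finset.sum_add_distrib, ← Finset.sum_mul, (S.predLaw_prob n).2,
      mul_left_comm, ← Finset.mul_sum]
    rw [← aTilde_eq, valueRate]
    ring
  have hspend : (spending s u n : ℝ) =
      ∑ j, ∑ k, indicator (decide (s n j k = some false) && u n j k) := by
    rw [spending, Finset.natCast_card_filter, Fintype.sum_prod_type]
    rfl
  rw [hψ, hspend, potential, Finset.mul_sum, add_comm, add_assoc, add_assoc]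
  congr 1
  rw [← Finset.sum_add_distrib, ← Finset.sum_add_distrib]
  refine Finset.sum_congr rfl fun j _ => ?_
  rw [Finset.mul_sum, ← Finset.sum_add_distrib, ← Finset.sum_add_distrib]
  exact Finset.sum_congr rfl fun k _ => sum_success_packet n b c G U j (s n j k) (u n j k)

end System
end TimelyThroughput

end

noncomputable section

namespace TimelyThroughput
namespace System

variable {N : ℕ} {S : System N}

/-! ### The law of the state -/

theorem stateProb_nonneg (π : S.Policy) (s₀ : S.State) (t : ℕ) (s : S.State) :
    0 ≤ stateProb π s₀ t s := by
  induction t generalizing s with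
  | zero => unfold stateProb; split_ifs <;> norm_num
  | succ t ih =>
    unfold stateProb
    refine Finset.sum_nonneg fun r _ => Finset.sum_nonneg fun u _ => Finset.sum_nonneg fun ω _ => ?_
    split_ifs
    · exact mul_nonneg (mul_nonneg (ih r) ((π r).2.1 u)) (noiseProb_nonneg r u ω)
    · exact le_rfl

theorem sum_stateProb_succ_mul (π : S.Policy) (s₀ : S.State) (t : ℕ) (F : S.State → ℝ) :
    ∑ s, stateProb π s₀ (t + 1) s * F s =
      ∑ s, ∑ u, stateProb π s₀ t s * (π s).1 u * ∑ ω, noiseProb s u ω * F (next s u ω) := by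
  simp_rw [stateProb, Finset.sum_mul]
  rw [Finset.sum_comm]
  refine Finset.sum_congr rfl fun s _ => ?_
  rw [Finset.sum_comm]
  refine Finset.sum_congr rfl fun u _ => ?_
  rw [Finset.sum_comm, Finset.mul_sum]
  refine Finset.sum_congr rfl fun ω _ => ?_
  simp_rw [ite_mul, zero_mul]
  rw [Finset.sum_ite_eq, if_pos (Finset.mem_univ _), mul_assoc]

theorem sum_stateProb (π : S.Policy) (s₀ : S.State) (t : ℕ) : ∑ s, stateProb π s₀ t s = 1 := by
  induction t with
  | zero => simp [stateProb]
  | succ t ih =>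
    have h := sum_stateProb_succ_mul π s₀ t fun _ => 1
    simp only [mul_one, sum_noiseProb, ← Finset.mul_sum, (π _).2.2, ih] at h
    exact h

/-- The state space is finite, so expected potentials are bounded uniformly in `t`, as the Poisson
lemmas require. -/
theorem abs_sum_stateProb_mul_le (π : S.Policy) (s₀ : S.State) (t : ℕ) (F : S.State → ℝ) :
    |∑ s, stateProb π s₀ t s * F s| ≤ ∑ s, |F s| := by
  refine (Finset.abs_sum_le_sum_abs _ _).trans (Finset.sum_le_sum fun s _ => ?_)
  rw [abs_mul, abs_of_nonneg (stateProb_nonneg π s₀ t s)]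
  refine mul_le_of_le_one_left (abs_nonneg _) ?_
  rw [← sum_stateProb π s₀ t]
  exact Finset.single_le_sum (fun r _ => stateProb_nonneg π s₀ t r) (Finset.mem_univ s)

/-- The balance of the expected value of the packets of user `n` in one slot. -/
theorem expected_balance (π : S.Policy) (s₀ : S.State) (t : ℕ) (n : Fin N) (b c : ℝ)
    {G U : ℕ → ℝ} (hG : G 0 = 0) (hU : U 0 = S.p n * G (S.τ n)) :
    b * expDeliveries π s₀ t n - c * expSpending π s₀ t n +
        ∑ s, stateProb π s₀ (t + 1) s * potential n b G U s -
        ∑ s, stateProb π s₀ t s * potential n b G U s =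
      S.valueRate n G U + ∑ s, stateProb π s₀ t s * ∑ u, (π s).1 u *
        ∑ j, ∑ k, if s n j k = some false then S.gap n b c G U j (indicator (u n j k)) else 0 := by
  have hone : ∀ F : S.State → ℝ, ∑ s, stateProb π s₀ t s * F s =
      ∑ s, ∑ u, stateProb π s₀ t s * (π s).1 u * F s := by
    intro F
    refine Finset.sum_congr rfl fun s _ => ?_
    rw [← Finset.sum_mul, ← Finset.mul_sum, (π s).2.2, mul_one]
  have hrate : S.valueRate n G U =
      ∑ s, ∑ u, stateProb π s₀ t s * (π s).1 u * S.valueRate n G U := by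
    rw [← hone fun _ => S.valueRate n G U, ← Finset.sum_mul, sum_stateProb, one_mul]
  rw [hrate, hone, sum_stateProb_succ_mul, expDeliveries, expSpending]
  simp_rw [Finset.mul_sum (Finset.univ : Finset S.State), Finset.mul_sum (Finset.univ : Finset S.Action)]
  rw [← Finset.sum_sub_distrib, ← Finset.sum_add_distrib, ← Finset.sum_sub_distrib,
    ← Finset.sum_add_distrib]
  refine Finset.sum_congr rfl fun s _ => ?_
  rw [← Finset.sum_sub_distrib, ← Finset.sum_add_distrib, ← Finset.sum_sub_distrib,
    ← Finset.sum_add_distrib]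
  refine Finset.sum_congr rfl fun u _ => ?_
  have h := sum_noiseProb_mul_potential s u n b c hG hU
  have hsplit : ∑ ω, noiseProb s u ω *
      (b * (deliveries s u ω n : ℝ) + potential n b G U (next s u ω)) =
      b * ∑ ω, noiseProb s u ω * (deliveries s u ω n : ℝ) +
        ∑ ω, noiseProb s u ω * potential n b G U (next s u ω) := by
    rw [Finset.mul_sum, ← Finset.sum_add_distrib]
    exact Finset.sum_congr rfl fun ω _ => by ring
  have hdel : ∑ ω, stateProb π s₀ t s * (π s).1 u * noiseProb s u ω * (deliveries s u ω n : ℝ) =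
      stateProb π s₀ t s * (π s).1 u * ∑ ω, noiseProb s u ω * (deliveries s u ω n : ℝ) := by
    rw [Finset.mul_sum]
    exact Finset.sum_congr rfl fun ω _ => by ring
  rw [hsplit] at h
  rw [hdel]
  linear_combination (stateProb π s₀ t s * (π s).1 u) * h

/-! ### Policies that transmit independently -/

theorem sum_transmission_weight (a : ℝ) : ∑ b : Bool, (if b = true then a else 1 - a) = 1 := by
  simp

/-- The policy that transmits a packet of user `n` in position `j` with probability `α n j`,
independently of everything else. -/
def independentPolicy (S : System N) (α : Fin N → ℕ → ℝ) (hα : ∀ n j, α n j ∈ Set.Icc (0 : ℝ) 1) :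
    S.Policy := fun _ =>
  ⟨fun u => ∏ n, ∏ j, ∏ k, if u n j k = true then α n j else 1 - α n j, by
    refine fun u => Finset.prod_nonneg fun n _ => Finset.prod_nonneg fun j _ =>
      Finset.prod_nonneg fun k _ => ?_
    split_ifs
    · exact (hα n j).1
    · linarith [(hα n j).2],
    sum_triple_prod (fun n (j : Fin (S.τ n + S.D n)) b => if b = true then α n j else 1 - α n j)
      fun _ _ => sum_transmission_weight _⟩

/-- The gap is affine in the transmission probability, so randomizing a decision amounts to
inserting its mean. -/
theorem sum_transmission_gap (n : Fin N) (b c : ℝ) (G U : ℕ → ℝ) (j : ℕ) (a : ℝ) :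
    ∑ o : Bool, (if o = true then a else 1 - a) * S.gap n b c G U j (indicator o) =
      S.gap n b c G U j a := by
  unfold gap indicator
  by_cases hj : j < S.τ n <;> simp [hj] <;> ring

theorem independentPolicy_balance (α : Fin N → ℕ → ℝ) (hα : ∀ n j, α n j ∈ Set.Icc (0 : ℝ) 1)
    (s : S.State) (n : Fin N) (b c : ℝ) (G U : ℕ → ℝ)
    (h : ∀ j, S.gap n b c G U j (α n j) = 0) :
    ∑ u, (S.independentPolicy α hα s).1 u * (∑ j, ∑ k,
      if s n j k = some false then S.gap n b c G U j (indicator (u n j k)) else 0) = 0 := by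
  have key := sum_triple_prod_mul_sum (m := fun n => S.τ n + S.D n) (K := S.aMax)
    (fun n j b => if b = true then α n j else 1 - α n j) (fun _ _ => sum_transmission_weight _) n
    (fun j k o => if s n j k = some false then S.gap n b c G U j (indicator o) else 0)
  refine Eq.trans key ?_
  refine Finset.sum_eq_zero fun j _ => Finset.sum_eq_zero fun k _ => ?_
  by_cases hs : s n j k = some false
  · simp only [eq_true hs, ↓reduceIte]
    rw [sum_transmission_gap, h]
  · simp only [eq_false hs, ↓reduceIte, mul_zero, Finset.sum_const_zero]

/-- Vanishing gaps turn the one-slot balance into an exact Poisson equation with constant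
`valueRate`. -/
theorem tendsto_independentPolicy (α : Fin N → ℕ → ℝ) (hα : ∀ n j, α n j ∈ Set.Icc (0 : ℝ) 1)
    (s₀ : S.State) (n : Fin N) (b c : ℝ) {G U : ℕ → ℝ} (hG : G 0 = 0)
    (hU : U 0 = S.p n * G (S.τ n)) (h : ∀ j, S.gap n b c G U j (α n j) = 0) :
    Tendsto (fun T : ℕ => (1 / (T : ℝ)) * ∑ t ∈ Finset.range T,
      (b * expDeliveries (S.independentPolicy α hα) s₀ t n -
        c * expSpending (S.independentPolicy α hα) s₀ t n)) atTop (𝓝 (S.valueRate n G U)) := by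
  refine tendsto_average_of_poisson
    (H := fun t => ∑ s, stateProb (S.independentPolicy α hα) s₀ t s * potential n b G U s)
    (fun t => abs_sum_stateProb_mul_le _ s₀ t _) fun t => ?_
  rw [expected_balance _ s₀ t n b c hG hU]
  simp_rw [independentPolicy_balance α hα _ n b c G U h, mul_zero, Finset.sum_const_zero, add_zero]

/-! ### Values of packets -/

/-- Values of an undelivered packet with `m` slots left, when it is transmitted with probability
`α m` if `m + 1` slots are left; `r - ζ y` is the gain of a transmission. -/
def valueSeq (ζ r y₀ : ℝ) (α : ℕ → ℝ) : ℕ → ℝ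
  | 0 => y₀
  | m + 1 => valueSeq ζ r y₀ α m + α m * (r - ζ * valueSeq ζ r y₀ α m)

/-- Optimal values of an undelivered packet with `m` slots left. -/
def bestSeq (ζ r y₀ : ℝ) : ℕ → ℝ
  | 0 => y₀
  | m + 1 => bestSeq ζ r y₀ m + max 0 (r - ζ * bestSeq ζ r y₀ m)

/-- Values of packets that have arrived, if position `j` is transmitted with probability `α j`. -/
def presentSeq (S : System N) (n : Fin N) (b c : ℝ) (α : ℕ → ℝ) : ℕ → ℝ :=
  valueSeq (S.ζ n) (S.ζ n * b - c) 0 α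

/-- Values of predicted packets, if position `j` is transmitted with probability `α j`. -/
def predictedSeq (S : System N) (n : Fin N) (b c : ℝ) (α : ℕ → ℝ) : ℕ → ℝ :=
  valueSeq (S.ζ n) (S.ζ n * (S.p n * b) - c) (S.p n * S.presentSeq n b c α (S.τ n))
    fun k => α (k + S.τ n)

/-- Optimal values of packets that have arrived. -/
def bestPresent (S : System N) (n : Fin N) (lam : ℝ) : ℕ → ℝ :=
  bestSeq (S.ζ n) (S.ζ n * S.β n - lam) 0

/-- Optimal values of predicted packets. -/
def bestPredicted (S : System N) (n : Fin N) (lam : ℝ) : ℕ → ℝ :=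
  bestSeq (S.ζ n) (S.ζ n * (S.p n * S.β n) - lam) (S.p n * S.bestPresent n lam (S.τ n))

theorem gap_presentSeq_predictedSeq (n : Fin N) (b c : ℝ) (α : ℕ → ℝ) (j : ℕ) :
    S.gap n b c (S.presentSeq n b c α) (S.predictedSeq n b c α) j (α j) = 0 := by
  unfold gap
  split_ifs with hj
  · simp only [presentSeq, valueSeq]
    ring
  · obtain ⟨k, rfl⟩ := Nat.exists_eq_add_of_le' (not_lt.1 hj)
    rw [show k + S.τ n + 1 - S.τ n = k + 1 by omega, Nat.add_sub_cancel]
    simp only [predictedSeq, valueSeq]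
    ring

/-- The gain of a transmission of a packet in position `j` under optimal continuation. -/
def gain (S : System N) (n : Fin N) (lam : ℝ) (j : ℕ) : ℝ :=
  if j < S.τ n then S.ζ n * S.β n - lam - S.ζ n * S.bestPresent n lam j
  else S.ζ n * (S.p n * S.β n) - lam - S.ζ n * S.bestPredicted n lam (j - S.τ n)

/-- Bellman equation of a single packet: for `a` in `[0, 1]` the gap is nonpositive, and it vanishes
exactly under the condition in `IsOptimal`. -/
theorem gap_best (n : Fin N) (lam : ℝ) (j : ℕ) (a : ℝ) :
    S.gap n (S.β n) lam (S.bestPresent n lam) (S.bestPredicted n lam) j a =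
      a * S.gain n lam j - max 0 (S.gain n lam j) := by
  unfold gap gain
  split_ifs with hj
  · simp only [bestPresent, bestSeq]
    ring
  · obtain ⟨k, rfl⟩ := Nat.exists_eq_add_of_le' (not_lt.1 hj)
    rw [show k + S.τ n + 1 - S.τ n = k + 1 by omega, Nat.add_sub_cancel]
    simp only [bestPredicted, bestSeq]
    ring

/-- The maximal rate at which value is created by user `n`. -/
def bestRate (S : System N) (n : Fin N) (lam : ℝ) : ℝ :=
  S.valueRate n (S.bestPresent n lam) (S.bestPredicted n lam)

/-! ### The Lagrangian: upper bound and attainment -/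

theorem lagrangian_sum_eq (π : S.Policy) (s₀ : S.State) (lam : ℝ) (T : ℕ) :
    (∑ n, ∑ t ∈ Finset.range T, S.β n * expDeliveries π s₀ t n) -
        lam * ∑ t ∈ Finset.range T, ∑ n, expSpending π s₀ t n =
      ∑ t ∈ Finset.range T, ∑ n, (S.β n * expDeliveries π s₀ t n - lam * expSpending π s₀ t n) := by
  rw [Finset.sum_comm, Finset.mul_sum, ← Finset.sum_sub_distrib]
  refine Finset.sum_congr rfl fun t _ => ?_
  rw [Finset.mul_sum, ← Finset.sum_sub_distrib]

/-- No policy has a Lagrangian above the sum of the maximal rates. -/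
theorem HasLagrangian.le {π : S.Policy} {s₀ : S.State} {lam ℓ : ℝ}
    (h : HasLagrangian π s₀ lam ℓ) : ℓ ≤ lam * S.B + ∑ n, S.bestRate n lam := by
  let h₀ : S.State → ℝ := fun s =>
    ∑ n, potential n (S.β n) (S.bestPresent n lam) (S.bestPredicted n lam) s
  have hlim : Tendsto (fun T : ℕ => (1 / (T : ℝ)) * ∑ t ∈ Finset.range T,
      ∑ n, (S.β n * expDeliveries π s₀ t n - lam * expSpending π s₀ t n)) atTop
      (𝓝 (ℓ - lam * S.B)) := by
    have := h.sub_const (lam * S.B)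
    simpa only [add_sub_cancel_right, lagrangian_sum_eq] using this
  have := average_le_of_poisson (H := fun t => ∑ s, stateProb π s₀ t s * h₀ s)
    (ρ := ∑ n, S.bestRate n lam) (fun t => abs_sum_stateProb_mul_le π s₀ t h₀) (fun t => ?_) hlim
  · linarith
  · have hswap : ∀ t, ∑ s, stateProb π s₀ t s * h₀ s = ∑ n, ∑ s, stateProb π s₀ t s *
        potential n (S.β n) (S.bestPresent n lam) (S.bestPredicted n lam) s := by
      intro t
      simp_rw [h₀, Finset.mul_sum]
      exact Finset.sum_comm
    rw [hswap, hswap, ← Finset.sum_add_distrib, ← Finset.sum_sub_distrib]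
    refine Finset.sum_le_sum fun n _ => ?_
    rw [expected_balance π s₀ t n (S.β n) lam rfl rfl, bestRate]
    refine add_le_of_nonpos_right (Finset.sum_nonpos fun s _ => ?_)
    refine mul_nonpos_of_nonneg_of_nonpos (stateProb_nonneg π s₀ t s) ?_
    refine Finset.sum_nonpos fun u _ => mul_nonpos_of_nonneg_of_nonpos ((π s).2.1 u) ?_
    refine Finset.sum_nonpos fun j _ => Finset.sum_nonpos fun k _ => ?_
    split_ifs
    · rw [gap_best, indicator]
      -- Both pure decisions have nonpositive gap, hence so does every randomization over joint
      -- actions.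
      split_ifs
      · linarith [le_max_right 0 (S.gain n lam j)]
      · linarith [le_max_left 0 (S.gain n lam j)]
    · exact le_rfl

/-- Position `j` of user `n` is transmitted with probability `α n j`, and this is optimal for the
multiplier `lam`. -/
def IsOptimal (S : System N) (lam : ℝ) (α : Fin N → ℕ → ℝ) : Prop :=
  ∀ n j, α n j * S.gain n lam j = max 0 (S.gain n lam j)

/-- Throughput of user `n` when position `j` is transmitted with probability `α n j`. -/
def throughputRate (S : System N) (α : Fin N → ℕ → ℝ) (n : Fin N) : ℝ :=
  S.valueRate n (S.presentSeq n 1 0 (α n)) (S.predictedSeq n 1 0 (α n))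

/-- Resource expenditure for user `n` when position `j` is transmitted with probability `α n j`. -/
def spendingRate (S : System N) (α : Fin N → ℕ → ℝ) (n : Fin N) : ℝ :=
  S.valueRate n (S.presentSeq n 0 (-1) (α n)) (S.predictedSeq n 0 (-1) (α n))

section Independent

variable (α : Fin N → ℕ → ℝ) (hα : ∀ n j, α n j ∈ Set.Icc (0 : ℝ) 1) (s₀ : S.State)

theorem hasThroughput_independentPolicy (n : Fin N) :
    HasThroughput (S.independentPolicy α hα) s₀ n (S.throughputRate α n) := by
  have h := tendsto_independentPolicy α hα s₀ n 1 0 (G := S.presentSeq n 1 0 (α n))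
    (U := S.predictedSeq n 1 0 (α n)) rfl rfl (gap_presentSeq_predictedSeq n 1 0 (α n))
  simp only [one_mul, zero_mul, sub_zero] at h
  exact h

/-- Reward 0 and cost `-1` make the potential argument count transmissions. -/
theorem tendsto_spending_independentPolicy (n : Fin N) :
    Tendsto (fun T : ℕ => (1 / (T : ℝ)) * ∑ t ∈ Finset.range T,
      expSpending (S.independentPolicy α hα) s₀ t n) atTop (𝓝 (S.spendingRate α n)) := by
  have h := tendsto_independentPolicy α hα s₀ n 0 (-1) (G := S.presentSeq n 0 (-1) (α n))
    (U := S.predictedSeq n 0 (-1) (α n)) rfl rfl (gap_presentSeq_predictedSeq n 0 (-1) (α n))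
  simp only [zero_mul, neg_mul, one_mul, zero_sub, neg_neg] at h
  exact h

theorem hasSpending_independentPolicy :
    HasSpending (S.independentPolicy α hα) s₀ (∑ n, S.spendingRate α n) := by
  have h := tendsto_finsetSum Finset.univ fun n _ => tendsto_spending_independentPolicy α hα s₀ n
  refine h.congr fun T => ?_
  rw [← Finset.mul_sum, Finset.sum_comm]

/-- Both sides are the limit of the same averages, computed once with the optimal values and once
with throughput and spending separately. -/
theorem IsOptimal.bestRate_eq {lam : ℝ} (h : S.IsOptimal lam α) (n : Fin N)
    (hα : ∀ n j, α n j ∈ Set.Icc (0 : ℝ) 1) (s₀ : S.State) :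
    S.bestRate n lam = S.β n * S.throughputRate α n - lam * S.spendingRate α n := by
  have h₁ := tendsto_independentPolicy α hα s₀ n (S.β n) lam (G := S.bestPresent n lam)
    (U := S.bestPredicted n lam) rfl rfl fun j => by rw [gap_best, h n j, sub_self]
  have h₂ := ((hasThroughput_independentPolicy α hα s₀ n).const_mul (S.β n)).sub
    ((tendsto_spending_independentPolicy α hα s₀ n).const_mul lam)
  refine tendsto_nhds_unique h₁ (h₂.congr fun T => ?_)
  rw [Finset.sum_sub_distrib, ← Finset.mul_sum, ← Finset.mul_sum]
  ring

end Independent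

theorem HasThroughput.hasLagrangian {π : S.Policy} {s₀ : S.State} {x : Fin N → ℝ} {E : ℝ}
    (hx : ∀ n, HasThroughput π s₀ n (x n)) (hE : HasSpending π s₀ E) (lam : ℝ) :
    HasLagrangian π s₀ lam (∑ n, S.β n * x n - lam * E + lam * S.B) := by
  have h₁ := tendsto_finsetSum Finset.univ fun n _ => (hx n).const_mul (S.β n)
  refine ((h₁.sub (hE.const_mul lam)).add_const (lam * S.B)).congr fun T => ?_
  have hsum : ∑ n, S.β n * ((1 / (T : ℝ)) * ∑ t ∈ Finset.range T, expDeliveries π s₀ t n) =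
      (1 / (T : ℝ)) * ∑ n, ∑ t ∈ Finset.range T, S.β n * expDeliveries π s₀ t n := by
    rw [Finset.mul_sum]
    refine Finset.sum_congr rfl fun n _ => ?_
    rw [← Finset.mul_sum]
    ring
  rw [hsum]
  ring

/-- A policy that is optimal for `lam` attains the sum of the maximal rates. -/
theorem IsOptimal.hasLagrangian {lam : ℝ} {α : Fin N → ℕ → ℝ} (h : S.IsOptimal lam α)
    (hα : ∀ n j, α n j ∈ Set.Icc (0 : ℝ) 1) (s₀ : S.State) :
    HasLagrangian (S.independentPolicy α hα) s₀ lam (lam * S.B + ∑ n, S.bestRate n lam) := by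
  have h₁ := HasThroughput.hasLagrangian (hasThroughput_independentPolicy α hα s₀)
    (hasSpending_independentPolicy α hα s₀) lam
  convert h₁ using 1
  simp_rw [h.bestRate_eq α _ hα s₀, Finset.sum_sub_distrib, ← Finset.mul_sum]
  ring

theorem exists_isOptimal (S : System N) (lam : ℝ) :
    ∃ α : Fin N → ℕ → ℝ, (∀ n j, α n j ∈ Set.Icc (0 : ℝ) 1) ∧ S.IsOptimal lam α := by
  classical
  refine ⟨fun n j => if 0 < S.gain n lam j then 1 else 0, fun n j => ?_, fun n j => ?_⟩
  · dsimp only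
    split_ifs <;> simp
  · dsimp only
    split_ifs with h
    · rw [one_mul, max_eq_right h.le]
    · rw [zero_mul, max_eq_left (not_lt.1 h)]

theorem isGreatest_lagrangianValues (s₀ : S.State) (lam : ℝ) :
    IsGreatest (S.lagrangianValues s₀ lam) (lam * S.B + ∑ n, S.bestRate n lam) := by
  obtain ⟨α, hα, h⟩ := S.exists_isOptimal lam
  exact ⟨⟨_, h.hasLagrangian hα s₀⟩, fun ℓ ⟨_, hℓ⟩ => hℓ.le⟩

theorem dualFunction_eq (s₀ : S.State) (lam : ℝ) :
    S.dualFunction s₀ lam = lam * S.B + ∑ n, S.bestRate n lam :=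
  (isGreatest_lagrangianValues s₀ lam).csSup_eq

end System
end TimelyThroughput

end

noncomputable section

namespace TimelyThroughput
namespace System

variable {N : ℕ} {S : System N}

/-! ### The explicit formula -/

theorem bestSeq_of_nonpos {ζ r y₀ : ℝ} (h : r - ζ * y₀ ≤ 0) (m : ℕ) : bestSeq ζ r y₀ m = y₀ := by
  induction m with
  | zero => rfl
  | succ m ih => rw [bestSeq, ih, max_eq_left h, add_zero]

/-- Each transmission multiplies the remaining gain by `1 - ζ`, so it stays nonnegative;
transmitting is always optimal and the gains form a geometric series. -/
theorem bestSeq_of_nonneg {ζ r y₀ : ℝ} (hζ : 0 < ζ) (hζ' : ζ ≤ 1) (h : 0 ≤ r - ζ * y₀) (m : ℕ) :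
    bestSeq ζ r y₀ m = (1 - ζ) ^ m * y₀ + (1 - (1 - ζ) ^ m) / ζ * r := by
  induction m with
  | zero => simp [bestSeq]
  | succ m ih =>
    have hgain : r - ζ * ((1 - ζ) ^ m * y₀ + (1 - (1 - ζ) ^ m) / ζ * r) =
        (1 - ζ) ^ m * (r - ζ * y₀) := by
      field_simp
      ring
    have hnonneg : 0 ≤ (1 - ζ) ^ m * (r - ζ * y₀) :=
      mul_nonneg (pow_nonneg (by linarith) _) h
    rw [bestSeq, ih, hgain, max_eq_right hnonneg]
    field_simp
    ring

theorem bestRate_of_le {n : Fin N} {lam : ℝ} (hlam : 0 ≤ lam) (h : S.ζ n * S.β n ≤ lam) :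
    S.bestRate n lam = 0 := by
  have hp : 0 ≤ S.p n := (S.q_nonneg n).trans (S.q_lt_p n).le
  have hG : S.bestPresent n lam (S.τ n) = 0 :=
    bestSeq_of_nonpos (by linarith) _
  have hle : S.ζ n * (S.p n * S.β n) ≤ lam := by
    have := mul_le_mul_of_nonneg_left h hp
    nlinarith [S.p_le_one n]
  have hU : S.bestPredicted n lam (S.D n) = 0 := by
    rw [bestPredicted, hG, mul_zero]
    exact bestSeq_of_nonpos (by linarith) _
  rw [bestRate, valueRate, hG, hU]
  ring

theorem bestPresent_of_lt {n : Fin N} {lam : ℝ} (h : lam < S.ζ n * S.β n) (m : ℕ) :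
    S.bestPresent n lam m = (1 - (1 - S.ζ n) ^ m) / S.ζ n * (-lam + S.ζ n * S.β n) := by
  rw [bestPresent, bestSeq_of_nonneg (S.ζ_pos n) (S.ζ_le_one n) (by linarith)]
  ring

/-- The initial gain decides the whole prediction window, and its sign is that of `p n` minus the
threshold `c`, up to a positive factor when the denominator is positive. -/
theorem bestPredicted_of_lt {n : Fin N} {lam : ℝ} (hlam : 0 ≤ lam) (h : lam < S.ζ n * S.β n) :
    S.bestPredicted n lam (S.D n) = S.v lam n := by
  have hζ := S.ζ_pos n
  have hp : 0 < S.p n := (S.q_nonneg n).trans_lt (S.q_lt_p n)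
  have hG := bestPresent_of_lt h (S.τ n)
  have hpow : 0 ≤ (1 - S.ζ n) ^ S.τ n := pow_nonneg (by linarith [S.ζ_le_one n]) _
  have hpow' : 0 ≤ (-lam + S.ζ n * S.β n) * (1 - S.ζ n) ^ S.τ n := mul_nonneg (by linarith) hpow
  have hgain : S.ζ n * (S.p n * S.β n) - lam - S.ζ n * (S.p n * S.bestPresent n lam (S.τ n)) =
      S.p n * ((-lam + S.ζ n * S.β n) * (1 - S.ζ n) ^ S.τ n + lam) - lam := by
    rw [hG]
    field_simp
    ring
  rw [bestPredicted, v]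
  split_ifs with hc
  · rw [bestSeq_of_nonpos, hG]
    · ring
    · rw [hgain]
      -- If the denominator is zero, the threshold is 0 by the convention for division, which
      -- contradicts `0 < p n`.
      rcases (add_nonneg hpow' hlam).eq_or_lt with h0 | h0
      · rw [c, ← h0, div_zero] at hc
        linarith
      · rw [c, le_div_iff₀ h0] at hc
        linarith
  · rw [bestSeq_of_nonneg hζ (S.ζ_le_one n), hG]
    · rw [pow_add]
      field_simp
      ring
    · rw [hgain]
      rcases (add_nonneg hpow' hlam).eq_or_lt with h0 | h0
      -- A zero denominator forces `lam = 0`, and the initial gain is then exactly 0.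
      · have : lam = 0 := by linarith
        rw [← h0, this]
        simp
      · rw [c, le_div_iff₀ h0] at hc
        linarith

theorem dualFormula_eq {lam : ℝ} (hlam : 0 ≤ lam) :
    S.dualFormula lam = lam * S.B + ∑ n, S.bestRate n lam := by
  classical
  rw [dualFormula, Finset.sum_filter]
  congr 1
  refine Finset.sum_congr rfl fun n _ => ?_
  split_ifs with h
  · rw [bestRate, valueRate, bestPredicted_of_lt hlam h, bestPresent_of_lt h]
    ring
  · rw [bestRate_of_le hlam (not_lt.1 h)]

/-! ### Complementary slackness -/

theorem continuous_valueSeq (ζ r : ℝ) {X : Type*} [TopologicalSpace X] {y₀ : X → ℝ}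
    {α : X → ℕ → ℝ} (hy : Continuous y₀) (hα : ∀ m, Continuous fun x => α x m) (m : ℕ) :
    Continuous fun x => valueSeq ζ r (y₀ x) (α x) m := by
  induction m with
  | zero => exact hy
  | succ m ih =>
    simp only [valueSeq]
    exact ih.add ((hα m).mul (continuous_const.sub (continuous_const.mul ih)))

theorem continuous_bestSeq (ζ : ℝ) {X : Type*} [TopologicalSpace X] {r y₀ : X → ℝ}
    (hr : Continuous r) (hy : Continuous y₀) (m : ℕ) :
    Continuous fun x => bestSeq ζ (r x) (y₀ x) m := by
  induction m with
  | zero => exact hy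
  | succ m ih =>
    simp only [bestSeq]
    exact ih.add (continuous_const.max (hr.sub (continuous_const.mul ih)))

theorem continuous_spendingRate (n : Fin N) :
    Continuous fun α : Fin N → ℕ → ℝ => S.spendingRate α n := by
  have hα : ∀ m, Continuous fun α : Fin N → ℕ → ℝ => α n m := fun m => by fun_prop
  have hG : ∀ m, Continuous fun α : Fin N → ℕ → ℝ => S.presentSeq n 0 (-1) (α n) m :=
    continuous_valueSeq _ _ continuous_const hα
  have hU : ∀ m, Continuous fun α : Fin N → ℕ → ℝ => S.predictedSeq n 0 (-1) (α n) m :=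
    continuous_valueSeq _ _ (continuous_const.mul (hG _)) fun m => hα _
  exact (continuous_const.mul (hU _)).add (continuous_const.mul (hG _))

theorem continuous_gain (n : Fin N) (j : ℕ) : Continuous fun lam => S.gain n lam j := by
  have hG : ∀ m, Continuous fun lam => S.bestPresent n lam m :=
    continuous_bestSeq _ (by fun_prop) continuous_const
  have hU : ∀ m, Continuous fun lam => S.bestPredicted n lam m :=
    continuous_bestSeq _ (by fun_prop) (continuous_const.mul (hG _))
  unfold gain
  split_ifs
  · exact (by fun_prop : Continuous fun lam => S.ζ n * S.β n - lam).sub (continuous_const.mul (hG _))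
  · exact (by fun_prop : Continuous fun lam => S.ζ n * (S.p n * S.β n) - lam).sub
      (continuous_const.mul (hU _))

/-- Gains are continuous in the multiplier, so optimality survives limits of multipliers and
policies jointly. -/
theorem isClosed_isOptimal (S : System N) :
    IsClosed {x : ℝ × (Fin N → ℕ → ℝ) | S.IsOptimal x.1 x.2} := by
  simp only [IsOptimal, Set.ofPred_forall]
  refine isClosed_iInter fun n => isClosed_iInter fun j => ?_
  have hg : Continuous fun x : ℝ × (Fin N → ℕ → ℝ) => S.gain n x.1 j :=
    (continuous_gain n j).comp continuous_fst
  exact isClosed_eq ((by fun_prop : Continuous fun x : ℝ × (Fin N → ℕ → ℝ) => x.2 n j).mul hg)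
    (continuous_const.max hg)

theorem gain_nonpos {n : Fin N} {lam : ℝ} (hlam : 0 ≤ lam) (h : S.ζ n * S.β n ≤ lam) (j : ℕ) :
    S.gain n lam j ≤ 0 := by
  have hp : 0 ≤ S.p n := (S.q_nonneg n).trans (S.q_lt_p n).le
  have hle : S.ζ n * (S.p n * S.β n) ≤ lam := by
    have := mul_le_mul_of_nonneg_left h hp
    nlinarith [S.p_le_one n]
  have hG : ∀ m, S.bestPresent n lam m = 0 := bestSeq_of_nonpos (by linarith)
  have hU : ∀ m, S.bestPredicted n lam m = 0 := by
    rw [bestPredicted, hG, mul_zero]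
    exact bestSeq_of_nonpos (by linarith)
  rw [gain]
  split_ifs
  · rw [hG]; linarith
  · rw [hU]; linarith

theorem valueSeq_zero (ζ r y₀ : ℝ) (m : ℕ) : valueSeq ζ r y₀ (fun _ => 0) m = y₀ := by
  induction m with
  | zero => rfl
  | succ m ih => rw [valueSeq, ih]; ring

theorem spendingRate_zero (n : Fin N) : S.spendingRate (fun _ _ => 0) n = 0 := by
  simp [spendingRate, valueRate, presentSeq, predictedSeq, valueSeq_zero]

/-- There are a multiplier and an optimal policy for it that satisfy complementary slackness. -/
theorem exists_complementary_slackness (S : System N) :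
    ∃ (lam : ℝ) (α : Fin N → ℕ → ℝ), 0 ≤ lam ∧ (∀ n j, α n j ∈ Set.Icc (0 : ℝ) 1) ∧
      S.IsOptimal lam α ∧ ∑ n, S.spendingRate α n ≤ S.B ∧
      lam * (S.B - ∑ n, S.spendingRate α n) = 0 := by
  let E : (Fin N → ℕ → ℝ) → ℝ := fun α => ∑ n, S.spendingRate α n
  have hE : Continuous E := continuous_finsetSum _ fun n _ => continuous_spendingRate n
  -- At the price `Λ`, at least every `ζ n * β n`, no transmission has positive gain; never
  -- transmitting is optimal and free.
  let Λ : ℝ := ∑ n, S.ζ n * S.β n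
  have hζβ : ∀ n, 0 ≤ S.ζ n * S.β n := fun n => mul_nonneg (S.ζ_pos n).le (S.β_nonneg n)
  have hΛ : 0 ≤ Λ := Finset.sum_nonneg fun n _ => hζβ n
  let cube : Set (Fin N → ℕ → ℝ) := Set.univ.pi fun _ => Set.univ.pi fun _ => Set.Icc 0 1
  have hcube : ∀ α, α ∈ cube ↔ ∀ n j, α n j ∈ Set.Icc (0 : ℝ) 1 := fun α => by
    simp only [cube, Set.mem_univ_pi]
  let K : Set (ℝ × (Fin N → ℕ → ℝ)) :=
    Set.Icc 0 Λ ×ˢ cube ∩ {x | S.IsOptimal x.1 x.2}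
  have hK : IsCompact K :=
    (isCompact_Icc.prod (isCompact_univ_pi fun _ => isCompact_univ_pi fun _ =>
      isCompact_Icc)).inter_right S.isClosed_isOptimal
  have hEsnd : Continuous fun x : ℝ × (Fin N → ℕ → ℝ) => E x.2 := hE.comp continuous_snd
  have hlow : IsCompact (K ∩ {x | E x.2 ≤ S.B}) :=
    hK.inter_right (isClosed_le hEsnd continuous_const)
  have hne : (K ∩ {x | E x.2 ≤ S.B}).Nonempty := by
    refine ⟨(Λ, fun _ _ => 0), ⟨⟨⟨hΛ, le_rfl⟩, (hcube _).2 fun _ _ => by simp⟩, fun n j => ?_⟩, ?_⟩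
    · have : S.gain n Λ j ≤ 0 :=
        gain_nonpos hΛ (Finset.single_le_sum (fun m _ => hζβ m) (Finset.mem_univ n)) j
      simp [this]
    · simpa [E, spendingRate_zero] using S.B_nonneg
  -- The least multiplier at which some optimal policy fits the budget.
  obtain ⟨⟨lam, α⟩, ⟨⟨⟨hlam, hα⟩, hopt⟩, hB⟩, hmin⟩ :=
    hlow.exists_isMinOn hne continuous_fst.continuousOn
  change lam ∈ Set.Icc 0 Λ at hlam
  change E α ≤ S.B at hB
  rcases hlam.1.eq_or_lt with h0 | h0
  · exact ⟨lam, α, hlam.1, (hcube α).1 hα, hopt, hB, by rw [← h0, zero_mul]⟩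
  -- Below `lam` every optimal policy overspends, by minimality. The multipliers with an optimal
  -- policy spending at least `B` form a compact set, so `lam` belongs to it too.
  have hhigh : IsClosed (Prod.fst '' (K ∩ {x | S.B ≤ E x.2})) :=
    ((hK.inter_right (isClosed_le continuous_const hEsnd)).image continuous_fst).isClosed
  have hsub : Set.Ico 0 lam ⊆ Prod.fst '' (K ∩ {x | S.B ≤ E x.2}) := by
    intro μ hμ
    obtain ⟨α', hα', hopt'⟩ := S.exists_isOptimal μ
    have hmem : (μ, α') ∈ K := ⟨⟨⟨hμ.1, hμ.2.le.trans hlam.2⟩, (hcube α').2 hα'⟩, hopt'⟩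
    refine ⟨(μ, α'), ⟨hmem, ?_⟩, rfl⟩
    by_contra hlt
    have hlow' : E α' ≤ S.B := (not_le.1 hlt).le
    have hle : lam ≤ μ := hmin ⟨hmem, hlow'⟩
    exact absurd hle (not_le.2 hμ.2)
  have hlam_mem : lam ∈ Prod.fst '' (K ∩ {x | S.B ≤ E x.2}) := by
    refine hhigh.closure_subset_iff.2 hsub ?_
    rw [closure_Ico h0.ne]
    exact ⟨hlam.1, le_rfl⟩
  obtain ⟨⟨_, α'⟩, ⟨⟨⟨_, hα'⟩, hopt'⟩, hB'⟩, rfl⟩ := hlam_mem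
  change S.B ≤ E α' at hB'
  -- Optimality for a fixed multiplier is linear in the probabilities and so holds along the
  -- segment. Spending is continuous there and takes the value `B`.
  let γ : ℝ → Fin N → ℕ → ℝ := fun θ n j => (1 - θ) * α n j + θ * α' n j
  have hγ : Continuous γ := by fun_prop
  have hγ0 : γ 0 = α := by ext n j; simp [γ]
  have hγ1 : γ 1 = α' := by ext n j; simp [γ]
  obtain ⟨θ, hθ, hEθ⟩ : S.B ∈ (fun θ => E (γ θ)) '' Set.Icc 0 1 :=
    intermediate_value_Icc zero_le_one (hE.comp hγ).continuousOn
      ⟨by rwa [Function.comp_apply, hγ0], by rwa [Function.comp_apply, hγ1]⟩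
  rw [hcube] at hα hα'
  refine ⟨_, γ θ, hlam.1, fun n j => ?_, fun n j => ?_, hEθ.le, ?_⟩
  · exact (convex_Icc (0 : ℝ) 1) (hα n j) (hα' n j) (by linarith [hθ.2]) hθ.1 (by ring)
  · have h₁ := hopt n j
    have h₂ := hopt' n j
    simp only [γ] at h₁ h₂ ⊢
    linear_combination (1 - θ) * h₁ + θ * h₂
  · rw [show ∑ n, S.spendingRate (γ θ) n = S.B from hEθ, sub_self, mul_zero]

/-- Weak duality. -/
theorem le_dualFunction_of_mem_feasibleValues {s₀ : S.State} {φ lam : ℝ}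
    (hφ : φ ∈ S.feasibleValues s₀) (hlam : 0 ≤ lam) : φ ≤ S.dualFunction s₀ lam := by
  obtain ⟨π, x, E, hx, hE, hEB, rfl⟩ := hφ
  have h := (HasThroughput.hasLagrangian hx hE lam).le
  rw [dualFunction_eq]
  nlinarith [mul_le_mul_of_nonneg_left hEB hlam]

end System
end TimelyThroughput

end

/-! ### Strong duality -/

theorem mainTheorem11 {N : ℕ} (S : TimelyThroughput.System N) (s₀ : S.State) :
    (∀ lam : ℝ, 0 ≤ lam →
      IsGreatest (S.lagrangianValues s₀ lam) (S.dualFunction s₀ lam) ∧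
        S.dualFunction s₀ lam = S.dualFormula lam) ∧
    IsGreatest (S.feasibleValues s₀) (S.optimalThroughput s₀) ∧
    IsLeast (S.dualFunction s₀ '' Set.Ici 0) (S.optimalThroughput s₀) := by
  obtain ⟨lam, α, hlam, hα, hopt, hB, hslack⟩ := S.exists_complementary_slackness
  have hmem : S.dualFunction s₀ lam ∈ S.feasibleValues s₀ := by
    refine ⟨_, _, _, TimelyThroughput.System.hasThroughput_independentPolicy α hα s₀,
      TimelyThroughput.System.hasSpending_independentPolicy α hα s₀, hB, ?_⟩
    rw [TimelyThroughput.System.dualFunction_eq]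
    simp_rw [hopt.bestRate_eq α _ hα s₀, Finset.sum_sub_distrib, ← Finset.mul_sum]
    -- The weighted throughput is the dual value minus `lam * (B - E)`, with `E` the spending, and
    -- this product vanishes by `hslack`.
    linarith
  have hgreatest : IsGreatest (S.feasibleValues s₀) (S.dualFunction s₀ lam) :=
    ⟨hmem, fun φ hφ => TimelyThroughput.System.le_dualFunction_of_mem_feasibleValues hφ hlam⟩
  have hφ : S.optimalThroughput s₀ = S.dualFunction s₀ lam := hgreatest.csSup_eq
  refine ⟨fun μ hμ => ⟨?_, ?_⟩, hφ ▸ hgreatest, ⟨lam, hlam, hφ.symm⟩, ?_⟩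
  · rw [TimelyThroughput.System.dualFunction_eq]
    exact TimelyThroughput.System.isGreatest_lagrangianValues s₀ μ
  · rw [TimelyThroughput.System.dualFunction_eq, TimelyThroughput.System.dualFormula_eq hμ]
  -- Weak duality at every `μ`, applied to the feasible value just attained, makes `lam` a minimizer
  -- of the dual function.
  · rintro _ ⟨μ, hμ, rfl⟩
    rw [hφ]
    exact TimelyThroughput.System.le_dualFunction_of_mem_feasibleValues hmem hμ
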